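/- Let $n \ge 3$ and $m \ge 1$ be integers, both even, and let $\alpha,\beta,\gamma$ be integers. Let $G$ be the group with generators $X, Y, Z$ and defining relations $$X^n = Z^{\alpha},\quad Y^2 = Z^{\beta},\quad YX = X^{n-1}YZ^{\gamma},\quad YZ = ZY,\quad XZ = ZX,\quad Z^m = 1.$$ Let $D_{2n}$ be the dihedral group of order $2n$ and $C_m$ the cyclic group of order $m$. Then the following are equivalent: (i) $G$ is a central extension $1 \to C_m \to G \to D_{2n} \to 1$, in which $C_m$ is generated by $Z$ and $X$, $Y$ are mapped to a rotation of order $n$ and a reflection of $D_{2n}$, and $G$ admits a faithful irreducible two-dimensional complex representation $\rho : G \to GL_2(\mathbb{C})$ whose projective image, that is, the image of $\rho(G)$ in $PGL_2(\mathbb{C})$, is isomorphic to $D_{2n}$; (ii) $\frac{n}{2}(\alpha+\gamma) \equiv \alpha + \frac{m}{2} \pmod m$. -/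

import Mathlib

/-- The three generators `X`, `Y`, `Z`. -/
inductive DihExtGen
  | X
  | Y
  | Z

/-- The relators of the presentation
`⟨X, Y, Z | X ^ n = Z ^ α, Y ^ 2 = Z ^ β, Y X = X ^ (n - 1) Y Z ^ γ, Y Z = Z Y, X Z = Z X, Z ^ m = 1⟩`.
The last relation says that the exponents of `Z` are read modulo `m`. -/
def dihExtRels (n m : ℕ) (α β γ : ℤ) : Set (FreeGroup DihExtGen) :=
  let X := FreeGroup.of DihExtGen.X
  let Y := FreeGroup.of DihExtGen.Y
  let Z := FreeGroup.of DihExtGen.Z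
  {X ^ n * (Z ^ α)⁻¹,
    Y ^ 2 * (Z ^ β)⁻¹,
    Y * X * (X ^ (n - 1) * Y * Z ^ γ)⁻¹,
    Y * Z * (Z * Y)⁻¹,
    X * Z * (Z * X)⁻¹,
    Z ^ m}

/-- The group `G` is given by `⟨X, Y, Z⟩, (α, β, γ)`: the elements `X`, `Y`, `Z` of `G` generate `G`
subject to exactly the relations `dihExtRels n m α β γ` and their consequences. -/
def IsGivenBy {G : Type*} [Group G] (n m : ℕ) (X Y Z : G) (α β γ : ℤ) : Prop :=
  ∃ e : PresentedGroup (dihExtRels n m α β γ) ≃* G,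
    e (PresentedGroup.of DihExtGen.X) = X ∧
    e (PresentedGroup.of DihExtGen.Y) = Y ∧
    e (PresentedGroup.of DihExtGen.Z) = Z

/-- `G` is a central extension `1 → C_m → G → D_{2n} → 1` in which `Z` is the image of the standard
generator of `C_m`, while `X` and `Y` lift the standard rotation and a reflection of the dihedral
group `D_{2n}` of order `2 n`. -/
def IsDihedralCentralExtension {G : Type*} [Group G] (n m : ℕ) (X Y Z : G) : Prop :=
  ∃ S : GroupExtension (Multiplicative (ZMod m)) G (DihedralGroup n),
    S.inl.range ≤ Subgroup.center G ∧
    S.inl (Multiplicative.ofAdd 1) = Z ∧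
    S.rightHom X = DihedralGroup.r 1 ∧
    S.rightHom Y = DihedralGroup.sr 0

/-- The representation on `ℂ²` (column vectors) attached to a homomorphism `G → GL₂(ℂ)`. -/
noncomputable def repOfGL {G : Type*} [Group G] (ρ : G →* Matrix.GeneralLinearGroup (Fin 2) ℂ) :
    Representation ℂ G (Fin 2 → ℂ) :=
  (Matrix.toLinAlgEquiv' : Matrix (Fin 2) (Fin 2) ℂ ≃ₐ[ℂ] _).toMonoidHom.comp
    ((Units.coeHom (Matrix (Fin 2) (Fin 2) ℂ)).comp ρ)

/-- The projective image of `ρ`: the image of `ρ(G)` in `PGL₂(ℂ) = GL₂(ℂ) / Z(GL₂(ℂ))`. -/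
def projImage {G : Type*} [Group G] (ρ : G →* Matrix.GeneralLinearGroup (Fin 2) ℂ) :
    Subgroup (Matrix.ProjGenLinGroup (Fin 2) ℂ) :=
  (Matrix.ProjGenLinGroup.mk.comp ρ).range

open Matrix (GeneralLinearGroup ProjGenLinGroup)
open scoped Matrix

/-! The relations give `Y X Y⁻¹ = X⁻¹ Z ^ (α + γ)`. Applied to `X ^ n = Z ^ α` this forces `Z ^ ((α
+ γ) n) = Z ^ (2 α)`. If `Z` has order `m`, then `(n / 2) (α + γ)` is `α` or `α + m / 2` modulo `m`.
In the first case `X ^ (n / 2)` commutes with `Y`, hence is central; by Schur's lemma it becomes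
scalar, and the projective image has order below `2 n` (`not_projImage_equiv`).

In the second case take roots of unity `ζ`, `ω` of exact orders `m`, `n`, and send `Z` to `ζ`, `X`
to `diag (a, b)` with `a b = ζ ^ (α + γ)` and `a / b = ω`, and `Y` to a multiple of the swap. The
congruence is what makes `a ^ n = b ^ n = ζ ^ α` (`exists_eigenvalues`). By `normal_form`, only
powers of `Z` become scalar, which yields both faithfulness and the projective image. -/

/-- The defining relations of `dihExtRels`, as equations between elements of a group. -/
structure DihExtRelations {H : Type*} [Group H] (n m : ℕ) (α β γ : ℤ) (X Y Z : H) : Prop where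
  pow_X : X ^ n = Z ^ α
  sq_Y : Y ^ 2 = Z ^ β
  Y_mul_X : Y * X = X ^ (n - 1) * Y * Z ^ γ
  commute_YZ : Commute Y Z
  commute_XZ : Commute X Z
  pow_Z : Z ^ m = 1

/-! ### Consequences of the relations in an arbitrary group -/

namespace DihExtRelations

variable {H : Type*} [Group H] {n m : ℕ} {α β γ : ℤ} {X Y Z : H}

/-- `Y X Y⁻¹ = X⁻¹ Z ^ (α + γ)`. -/
theorem conj_X (h : DihExtRelations n m α β γ X Y Z) (hn : 0 < n) :
    Y * X * Y⁻¹ = X⁻¹ * Z ^ (α + γ) := by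
  have h1 : X ^ (n - 1) = X⁻¹ * Z ^ α := by
    rw [← h.pow_X, eq_inv_mul_iff_mul_eq, ← pow_succ', Nat.sub_add_cancel hn]
  have h2 : Y * Z ^ γ * Y⁻¹ = Z ^ γ := by
    rw [(h.commute_YZ.zpow_right γ).eq, mul_inv_cancel_right]
  rw [h.Y_mul_X, h1, zpow_add]
  calc X⁻¹ * Z ^ α * Y * Z ^ γ * Y⁻¹ = X⁻¹ * Z ^ α * (Y * Z ^ γ * Y⁻¹) := by group
    _ = _ := by rw [h2]; group

theorem conj_X_zpow (h : DihExtRelations n m α β γ X Y Z) (hn : 0 < n) (i : ℤ) :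
    Y * X ^ i * Y⁻¹ = X ^ (-i) * Z ^ ((α + γ) * i) := by
  rw [← conj_zpow, h.conj_X hn,
    ((h.commute_XZ.zpow_right (α + γ)).inv_left).mul_zpow, ← zpow_mul, inv_zpow, zpow_neg]

theorem Y_mul_X_zpow (h : DihExtRelations n m α β γ X Y Z) (hn : 0 < n) (i : ℤ) :
    Y * X ^ i = X ^ (-i) * Y * Z ^ ((α + γ) * i) := by
  rw [mul_assoc, (h.commute_YZ.zpow_right _).eq, ← mul_assoc, ← h.conj_X_zpow hn i,
    inv_mul_cancel_right]

/-- `Y` fixes `X ^ n = Z ^ α` under conjugation, yet the conjugation formula gives `Z ^ (-α) * Z ^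
((α + γ) n)`. This is the target congruence up to a factor of 2. -/
theorem Z_zpow_double (h : DihExtRelations n m α β γ X Y Z) (hn : 0 < n) :
    Z ^ ((α + γ) * n) = Z ^ (2 * α) := by
  have h1 := h.conj_X_zpow hn n
  rw [zpow_neg, zpow_natCast, h.pow_X, (h.commute_YZ.zpow_right α).eq, mul_inv_cancel_right,
    eq_inv_mul_iff_mul_eq, ← zpow_add] at h1
  rw [← h1, two_mul]

/-- Every element of a group generated by `X, Y, Z` has the form `X ^ i Z ^ k` or
`X ^ i Y Z ^ k`. -/
theorem normal_form (h : DihExtRelations n m α β γ X Y Z) (hn : 0 < n)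
    (hgen : Subgroup.closure {X, Y, Z} = ⊤) (g : H) :
    (∃ i k : ℤ, g = X ^ i * Z ^ k) ∨ ∃ i k : ℤ, g = X ^ i * Y * Z ^ k := by
  have hg : g ∈ Subgroup.closure {X, Y, Z} := hgen ▸ Subgroup.mem_top g
  have hX (i j k : ℤ) : X ^ i * Z ^ k * X ^ j = X ^ (i + j) * Z ^ k := by
    rw [mul_assoc, ← (h.commute_XZ.zpow_zpow j k).eq, ← mul_assoc, zpow_add]
  have hXY (i j k : ℤ) :
      X ^ i * Y * Z ^ k * X ^ j = X ^ (i - j) * Y * Z ^ ((α + γ) * j + k) := by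
    rw [mul_assoc, ← (h.commute_XZ.zpow_zpow j k).eq, mul_assoc (X ^ i), ← mul_assoc Y,
      h.Y_mul_X_zpow hn, sub_eq_add_neg, zpow_add, zpow_add]
    simp only [mul_assoc]
  have hXZ (i j k : ℤ) : X ^ i * Z ^ k * Z ^ j = X ^ i * Z ^ (k + j) := by
    rw [mul_assoc, zpow_add]
  have hXYZ (i j k : ℤ) : X ^ i * Y * Z ^ k * Z ^ j = X ^ i * Y * Z ^ (k + j) := by
    rw [mul_assoc, zpow_add]
  have hY (i k : ℤ) : X ^ i * Z ^ k * Y = X ^ i * Y * Z ^ k := by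
    rw [mul_assoc, ← (h.commute_YZ.zpow_right k).eq, mul_assoc]
  have hYY (i k : ℤ) : X ^ i * Y * Z ^ k * Y = X ^ i * Z ^ (β + k) := by
    rw [mul_assoc, ← (h.commute_YZ.zpow_right k).eq, zpow_add, ← h.sq_Y, sq]
    simp only [mul_assoc]
  -- Reduces right multiplication by `Y⁻¹` to the cases of `Y` and of powers of `Z`.
  have hYinv : Y⁻¹ = Y * Z ^ (-β) := by
    rw [zpow_neg, ← h.sq_Y, sq, _root_.mul_inv_rev, mul_inv_cancel_left]
  induction hg using Subgroup.closure_induction_right with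
  | one => exact .inl ⟨0, 0, by simp⟩
  | mul_right x _ y hy ih =>
    obtain rfl | rfl | rfl := hy
    · rcases ih with ⟨i, k, rfl⟩ | ⟨i, k, rfl⟩
      · exact .inl ⟨_, _, by rw [← hX i 1 k, zpow_one]⟩
      · exact .inr ⟨_, _, by rw [← hXY i 1 k, zpow_one]⟩
    · rcases ih with ⟨i, k, rfl⟩ | ⟨i, k, rfl⟩
      · exact .inr ⟨_, _, hY ..⟩
      · exact .inl ⟨_, _, hYY ..⟩
    · rcases ih with ⟨i, k, rfl⟩ | ⟨i, k, rfl⟩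
      · exact .inl ⟨_, _, by rw [← hXZ i 1 k, zpow_one]⟩
      · exact .inr ⟨_, _, by rw [← hXYZ i 1 k, zpow_one]⟩
  | mul_inv_cancel x _ y hy ih =>
    obtain rfl | rfl | rfl := hy
    · rw [← zpow_neg_one y]
      rcases ih with ⟨i, k, rfl⟩ | ⟨i, k, rfl⟩
      · exact .inl ⟨_, _, hX ..⟩
      · exact .inr ⟨_, _, hXY ..⟩
    · rw [hYinv, ← mul_assoc]
      rcases ih with ⟨i, k, rfl⟩ | ⟨i, k, rfl⟩
      · exact .inr ⟨_, _, by rw [hY, hXYZ]⟩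
      · exact .inl ⟨_, _, by rw [hYY, hXZ]⟩
    · rw [← zpow_neg_one y]
      rcases ih with ⟨i, k, rfl⟩ | ⟨i, k, rfl⟩
      · exact .inl ⟨_, _, hXZ ..⟩
      · exact .inr ⟨_, _, hXYZ ..⟩

/-- The standard rotation and reflection of the dihedral group satisfy the relations, with `Z`
trivial. -/
theorem dihedralGroup (hn : 0 < n) :
    DihExtRelations n m α β γ (DihedralGroup.r 1 : DihedralGroup n) (DihedralGroup.sr 0) 1 where
  pow_X := by simp
  sq_Y := by simp [sq]
  Y_mul_X := by
    simp [Nat.cast_sub (show 1 ≤ n from hn)]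
  commute_YZ := Commute.one_right _
  commute_XZ := Commute.one_right _
  pow_Z := one_pow m

end DihExtRelations

/-! ### The presented group and its projection to the dihedral group -/

namespace IsGivenBy

variable {G : Type*} [Group G] {n m : ℕ} {α β γ : ℤ} {X Y Z : G}

theorem relations (hG : IsGivenBy n m X Y Z α β γ) : DihExtRelations n m α β γ X Y Z := by
  obtain ⟨e, rfl, rfl, rfl⟩ := hG
  obtain ⟨φ, key, hX, hY, hZ⟩ : ∃ φ : FreeGroup DihExtGen →* G,
      (∀ r ∈ dihExtRels n m α β γ, φ r = 1) ∧
      φ (FreeGroup.of .X) = e (PresentedGroup.of .X) ∧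
      φ (FreeGroup.of .Y) = e (PresentedGroup.of .Y) ∧
      φ (FreeGroup.of .Z) = e (PresentedGroup.of .Z) :=
    ⟨e.toMonoidHom.comp (PresentedGroup.mk _), fun r hr => by
      simp [PresentedGroup.one_of_mem hr], rfl, rfl, rfl⟩
  rw [← hX, ← hY, ← hZ]
  simp only [dihExtRels, Set.mem_insert_iff, Set.mem_singleton_iff, forall_eq_or_imp, forall_eq,
    map_mul, map_inv, map_pow, map_zpow, mul_inv_eq_one] at key
  obtain ⟨h1, h2, h3, h4, h5, h6⟩ := key
  exact ⟨h1, h2, h3, h4, h5, h6⟩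

theorem closure_eq_top (hG : IsGivenBy n m X Y Z α β γ) :
    Subgroup.closure {X, Y, Z} = ⊤ := by
  obtain ⟨e, rfl, rfl, rfl⟩ := hG
  have h := congrArg (Subgroup.map e.toMonoidHom)
    (PresentedGroup.closure_range_of (dihExtRels n m α β γ))
  rw [MonoidHom.map_closure, ← MonoidHom.range_eq_map,
    MonoidHom.range_eq_top_of_surjective _ e.surjective] at h
  rw [← top_le_iff, ← h, Subgroup.closure_le]
  rintro _ ⟨_, ⟨x, rfl⟩, rfl⟩
  apply Subgroup.subset_closure
  cases x <;> simp

/-- The universal property of the presentation. -/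
theorem exists_hom {H : Type*} [Group H] {x y z : H} (hG : IsGivenBy n m X Y Z α β γ)
    (h : DihExtRelations n m α β γ x y z) : ∃ f : G →* H, f X = x ∧ f Y = y ∧ f Z = z := by
  obtain ⟨e, rfl, rfl, rfl⟩ := hG
  let v : DihExtGen → H := fun g => DihExtGen.casesOn g x y z
  have hv : ∀ r ∈ dihExtRels n m α β γ, FreeGroup.lift v r = 1 := by
    simp only [dihExtRels, Set.mem_insert_iff, Set.mem_singleton_iff, forall_eq_or_imp, forall_eq,
      map_mul, map_inv, map_pow, map_zpow, mul_inv_eq_one, FreeGroup.lift_apply_of]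
    exact ⟨h.pow_X, h.sq_Y, h.Y_mul_X, h.commute_YZ, h.commute_XZ, h.pow_Z⟩
  refine ⟨(PresentedGroup.toGroup hv).comp e.symm.toMonoidHom, ?_, ?_, ?_⟩ <;> simp [v]

theorem mem_center (hG : IsGivenBy n m X Y Z α β γ) {g : G} (hX : Commute g X)
    (hY : Commute g Y) (hZ : Commute g Z) : g ∈ Subgroup.center G := by
  have : Subgroup.closure {X, Y, Z} ≤ Subgroup.centralizer {g} := by
    rw [Subgroup.closure_le]
    rintro _ (rfl | rfl | rfl) <;> simp only [SetLike.mem_coe, Subgroup.mem_centralizer_singleton_iff]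
    exacts [hX.eq.symm, hY.eq.symm, hZ.eq.symm]
  rw [hG.closure_eq_top] at this
  exact Subgroup.mem_center_iff.2 fun x =>
    Subgroup.mem_centralizer_singleton_iff.1 (this (Subgroup.mem_top x))

theorem Z_mem_center (hG : IsGivenBy n m X Y Z α β γ) : Z ∈ Subgroup.center G :=
  hG.mem_center hG.relations.commute_XZ.symm hG.relations.commute_YZ.symm (Commute.refl Z)

/-- The kernel of the projection onto the dihedral group is generated by `Z`. -/
theorem ker_eq_zpowers (hG : IsGivenBy n m X Y Z α β γ) (hn : 0 < n)
    {f : G →* DihedralGroup n} (hX : f X = DihedralGroup.r 1) (hY : f Y = DihedralGroup.sr 0)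
    (hZ : f Z = 1) : f.ker = Subgroup.zpowers Z := by
  apply le_antisymm
  · intro g hg
    rw [MonoidHom.mem_ker] at hg
    rcases hG.relations.normal_form hn hG.closure_eq_top g with ⟨i, k, rfl⟩ | ⟨i, k, rfl⟩
    · rw [map_mul, map_zpow, map_zpow, hX, hZ, one_zpow, mul_one, DihedralGroup.r_one_zpow,
        DihedralGroup.one_def, DihedralGroup.r.injEq, ZMod.intCast_zmod_eq_zero_iff_dvd] at hg
      obtain ⟨j, rfl⟩ := hg
      rw [zpow_mul, zpow_natCast, hG.relations.pow_X, ← zpow_mul, ← zpow_add]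
      exact Subgroup.zpow_mem_zpowers Z _
    · rw [map_mul, map_mul, map_zpow, map_zpow, hX, hY, hZ, one_zpow, mul_one,
        DihedralGroup.r_one_zpow, DihedralGroup.r_mul_sr, DihedralGroup.one_def] at hg
      cases hg
  · rw [Subgroup.zpowers_le, MonoidHom.mem_ker, hZ]

/-- The kernel of the projection is always generated by `Z`; the order of `Z` is what makes `C_m`
embed. -/
theorem isDihedralCentralExtension (hG : IsGivenBy n m X Y Z α β γ) (hn : 0 < n)
    (hZ : orderOf Z = m) : IsDihedralCentralExtension n m X Y Z := by
  obtain ⟨f, fX, fY, fZ⟩ := hG.exists_hom (DihExtRelations.dihedralGroup (n := n) hn)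
  have hker := hG.ker_eq_zpowers hn fX fY fZ
  have hZm : zmultiplesHom (Additive G) (Additive.ofMul Z) m = 0 := by
    rw [zmultiplesHom_apply, natCast_zsmul, ← ofMul_pow, hG.relations.pow_Z, ofMul_one]
  let φ : Multiplicative (ZMod m) →* G := (ZMod.lift m ⟨_, hZm⟩).toMultiplicativeLeft
  have hφ (k : ℤ) : φ (Multiplicative.ofAdd (k : ZMod m)) = Z ^ k := by
    change Additive.toMul (ZMod.lift m ⟨_, hZm⟩ (k : ZMod m)) = Z ^ k
    rw [ZMod.lift_coe]
    rfl
  have hrange : φ.range = Subgroup.zpowers Z := by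
    ext g
    constructor
    · rintro ⟨a, rfl⟩
      obtain ⟨k, hk⟩ := ZMod.intCast_surjective a.toAdd
      rw [← ofAdd_toAdd a, ← hk, hφ]
      exact Subgroup.zpow_mem_zpowers Z k
    · rintro ⟨k, rfl⟩
      exact ⟨_, hφ k⟩
  refine ⟨⟨φ, f, ?_, hrange.trans hker.symm, ?_⟩, ?_, ?_, fX, fY⟩
  · rw [injective_iff_map_eq_one]
    intro a ha
    obtain ⟨k, hk⟩ := ZMod.intCast_surjective a.toAdd
    rw [← ofAdd_toAdd a, ← hk, hφ, ← orderOf_dvd_iff_zpow_eq_one, hZ,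
      ← ZMod.intCast_zmod_eq_zero_iff_dvd] at ha
    rw [← ofAdd_toAdd a, ← hk, ha, ofAdd_zero]
  · rintro (i | i)
    · obtain ⟨k, rfl⟩ := ZMod.intCast_surjective i
      exact ⟨X ^ k, by rw [map_zpow, fX, DihedralGroup.r_one_zpow]⟩
    · obtain ⟨k, rfl⟩ := ZMod.intCast_surjective i
      exact ⟨Y * X ^ k, by
        rw [map_mul, map_zpow, fX, fY, DihedralGroup.r_one_zpow, DihedralGroup.sr_mul_r, zero_add]⟩
  · rw [hrange, Subgroup.zpowers_le]
    exact hG.Z_mem_center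
  · simpa using hφ 1

end IsGivenBy

theorem IsDihedralCentralExtension.orderOf_eq {G : Type*} [Group G] {n m : ℕ} {X Y Z : G}
    (h : IsDihedralCentralExtension n m X Y Z) : orderOf Z = m := by
  obtain ⟨S, -, rfl, -⟩ := h
  rw [orderOf_injective _ S.inl_injective, orderOf_ofAdd_eq_addOrderOf, ZMod.addOrderOf_one]

/-! ### Necessity: Schur's lemma and a count of the projective image -/

/-- Schur's lemma: an irreducible representation on `ℂ²` sends central elements to scalars. -/
theorem mk_eq_one_of_mem_center {G : Type*} [Group G]
    {ρ : G →* GeneralLinearGroup (Fin 2) ℂ} (hρ : (repOfGL ρ).IsIrreducible) {g : G}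
    (hg : g ∈ Subgroup.center G) : ProjGenLinGroup.mk (ρ g) = 1 := by
  obtain ⟨c, hc⟩ := Module.End.exists_eigenvalue (repOfGL ρ g)
  let W : Subrepresentation (repOfGL ρ) :=
    ⟨Module.End.eigenspace (repOfGL ρ g) c, fun x v hv => by
      rw [Module.End.mem_eigenspace_iff] at hv ⊢
      rw [← Module.End.mul_apply, ← map_mul, ← Subgroup.mem_center_iff.1 hg x, map_mul,
        Module.End.mul_apply, hv, map_smul]⟩
  have hW : W = ⊤ := by
    refine (hρ.eq_bot_or_eq_top W).resolve_left fun h => hc ?_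
    exact congrArg Subrepresentation.toSubmodule h
  have hsc (v : Fin 2 → ℂ) : repOfGL ρ g v = c • v :=
    Module.End.mem_eigenspace_iff.1 <|
      show v ∈ W.toSubmodule by rw [hW]; exact Submodule.mem_top
  have hmat : (ρ g : Matrix (Fin 2) (Fin 2) ℂ) = c • 1 := by
    apply (Matrix.toLin' (R := ℂ)).injective
    refine LinearMap.ext fun v => (hsc v).trans ?_
    simp
  rw [ProjGenLinGroup.mk_eq_one, Subgroup.mem_center_iff]
  intro x
  ext1
  rw [Units.val_mul, Units.val_mul, hmat, mul_smul_comm, smul_mul_assoc, mul_one, one_mul]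

/-- If `X ^ (n / 2)` is central, no irreducible representation has projective image of
order `2 n`. -/
theorem not_projImage_equiv {G : Type*} [Group G] {n m : ℕ} {α β γ : ℤ} {X Y Z : G}
    (hn : 0 < n) (hn2 : Even n) (hG : IsGivenBy n m X Y Z α β γ)
    (hX : X ^ (n / 2) ∈ Subgroup.center G)
    {ρ : G →* GeneralLinearGroup (Fin 2) ℂ} (hρ : (repOfGL ρ).IsIrreducible) :
    ¬ Nonempty (projImage ρ ≃* DihedralGroup n) := by
  rintro ⟨e⟩
  have : NeZero n := ⟨hn.ne'⟩
  obtain ⟨f, fX, fY, fZ⟩ := hG.exists_hom (DihExtRelations.dihedralGroup (n := n) hn)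
  have hker := hG.ker_eq_zpowers hn fX fY fZ
  have hfX : X ^ (n / 2) ∉ f.ker := by
    rw [MonoidHom.mem_ker, map_pow, fX, ← orderOf_dvd_iff_pow_eq_one, DihedralGroup.orderOf_r_one]
    intro h
    obtain ⟨k, rfl⟩ := hn2
    exact absurd (Nat.le_of_dvd (by omega) h) (by omega)
  -- The projective kernel contains `⟨Z⟩ = f.ker` and also `X ^ (n / 2)`, which `f` does not kill,
  -- so its index is too small.
  have hlt : f.ker < (ProjGenLinGroup.mk.comp ρ).ker := by
    refine lt_of_le_of_ne ?_ fun h => hfX (h ▸ mk_eq_one_of_mem_center hρ hX)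
    rw [hker, Subgroup.zpowers_le]
    exact mk_eq_one_of_mem_center hρ hG.Z_mem_center
  have : f.ker.FiniteIndex := ⟨by
    rw [Subgroup.index_ker]; exact Nat.card_pos.ne'⟩
  have hidx := Subgroup.index_strictAnti hlt
  rw [Subgroup.index_ker, Subgroup.index_ker] at hidx
  have h1 : Nat.card (ProjGenLinGroup.mk.comp ρ).range = Nat.card (DihedralGroup n) :=
    Nat.card_congr e.toEquiv
  exact absurd (Subgroup.card_le_card_group f.range) (by omega)

theorem Int.modEq_or_modEq_add_half {m : ℕ} (hm2 : Even m) {u v : ℤ}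
    (h : 2 * u ≡ 2 * v [ZMOD m]) : u ≡ v [ZMOD m] ∨ u ≡ v + (m / 2 : ℕ) [ZMOD m] := by
  obtain ⟨k, rfl⟩ := hm2
  obtain ⟨d, hd⟩ := h.dvd
  have hk : ((k + k) / 2 : ℕ) = k := by omega
  rw [hk]
  push_cast at hd ⊢
  have hd' : v - u = k * d := by linarith
  rcases Int.even_or_odd' d with ⟨t, rfl | rfl⟩
  · exact .inl (Int.modEq_iff_dvd.2 ⟨t, by linarith⟩)
  · exact .inr (Int.modEq_iff_dvd.2 ⟨t + 1, by linarith⟩)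

/-- The necessity of the congruence. -/
theorem congruence_of_representation {G : Type*} [Group G] {n m : ℕ} (hn : 0 < n)
    (hn2 : Even n) (hm2 : Even m) {X Y Z : G} {α β γ : ℤ} (hG : IsGivenBy n m X Y Z α β γ)
    (hE : IsDihedralCentralExtension n m X Y Z) {ρ : G →* GeneralLinearGroup (Fin 2) ℂ}
    (hρ : (repOfGL ρ).IsIrreducible) (hP : Nonempty (projImage ρ ≃* DihedralGroup n)) :
    ((n / 2 : ℕ) : ℤ) * (α + γ) ≡ α + ((m / 2 : ℕ) : ℤ) [ZMOD (m : ℤ)] := by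
  have hR := hG.relations
  have hnh : (n : ℤ) = 2 * (n / 2 : ℕ) := by
    have := hn2.two_dvd
    omega
  have hd : 2 * (((n / 2 : ℕ) : ℤ) * (α + γ)) ≡ 2 * α [ZMOD (m : ℤ)] := by
    rw [← hE.orderOf_eq, ← zpow_eq_zpow_iff_modEq, ← hR.Z_zpow_double hn, hnh]
    congr 1
    ring
  refine (Int.modEq_or_modEq_add_half hm2 hd).resolve_left fun h => ?_
  refine not_projImage_equiv hn hn2 hG ?_ hρ hP
  refine hG.mem_center ((Commute.refl X).pow_left _) ?_ (hR.commute_XZ.pow_left _)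
  rw [← hE.orderOf_eq, ← zpow_eq_zpow_iff_modEq] at h
  -- Here `Z ^ ((n / 2) (α + γ)) = Z ^ α = X ^ n`, so the conjugate is `X ^ (-n / 2 + n) = X ^ (n /
  -- 2)`.
  have hc := hR.conj_X_zpow hn (n / 2 : ℕ)
  rw [mul_comm (α + γ), h, ← hR.pow_X, ← zpow_natCast X n, ← zpow_add,
    show -((n / 2 : ℕ) : ℤ) + n = (n / 2 : ℕ) by omega, zpow_natCast, mul_inv_eq_iff_eq_mul] at hc
  exact hc.symm

/-! ### Diagonal and antidiagonal matrices, and the model representation -/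

/-- Invertible diagonal `2 × 2` matrices. -/
def diagGL : ℂˣ × ℂˣ →* GeneralLinearGroup (Fin 2) ℂ where
  toFun p := ⟨!![(p.1 : ℂ), 0; 0, p.2], !![((p.1⁻¹ : ℂˣ) : ℂ), 0; 0, ((p.2⁻¹ : ℂˣ) : ℂ)],
    by simp [Matrix.one_fin_two], by simp [Matrix.one_fin_two]⟩
  map_one' := by ext1; simp [Matrix.one_fin_two]
  map_mul' p q := by ext1; simp

/-- The matrix exchanging the two coordinates. -/
def swapGL : GeneralLinearGroup (Fin 2) ℂ :=
  ⟨!![0, 1; 1, 0], !![0, 1; 1, 0], by simp [Matrix.one_fin_two], by simp [Matrix.one_fin_two]⟩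

theorem coe_diagGL (p : ℂˣ × ℂˣ) :
    (diagGL p : Matrix (Fin 2) (Fin 2) ℂ) = !![(p.1 : ℂ), 0; 0, p.2] := rfl

theorem coe_swapGL : (swapGL : Matrix (Fin 2) (Fin 2) ℂ) = !![0, 1; 1, 0] := rfl

theorem swapGL_mul_diagGL (p : ℂˣ × ℂˣ) : swapGL * diagGL p = diagGL p.swap * swapGL := by
  ext1
  simp [coe_diagGL, coe_swapGL]

theorem swapGL_mul_self : swapGL * swapGL = 1 := by
  ext1
  simp [coe_swapGL, Matrix.one_fin_two]

theorem diagGL_injective : Function.Injective diagGL := by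
  intro p q h
  have h0 := congrArg (fun M : GeneralLinearGroup (Fin 2) ℂ => M.val 0 0) h
  have h1 := congrArg (fun M : GeneralLinearGroup (Fin 2) ℂ => M.val 1 1) h
  simp only [coe_diagGL] at h0 h1
  exact Prod.ext (Units.ext h0) (Units.ext h1)

theorem diagGL_mem_center_iff (p : ℂˣ × ℂˣ) :
    diagGL p ∈ Subgroup.center (GeneralLinearGroup (Fin 2) ℂ) ↔ p.1 = p.2 := by
  rw [Subgroup.mem_center_iff]
  constructor
  · intro h
    have h1 := (h swapGL).symm.trans (swapGL_mul_diagGL p)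
    exact congrArg Prod.fst (diagGL_injective (mul_right_cancel h1))
  · intro h x
    have hp : (diagGL p : Matrix (Fin 2) (Fin 2) ℂ) = (p.1 : ℂ) • 1 := by
      simp [coe_diagGL, h, Matrix.one_fin_two]
    ext1
    rw [Units.val_mul, Units.val_mul, hp, mul_smul_comm, smul_mul_assoc, mul_one, one_mul]

theorem diagGL_mul_swapGL_notMem_center (p : ℂˣ × ℂˣ) :
    diagGL p * swapGL ∉ Subgroup.center (GeneralLinearGroup (Fin 2) ℂ) := by
  intro h
  have h1 := congrArg (fun M : GeneralLinearGroup (Fin 2) ℂ => M.val 0 1)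
    -- `diag (1, -1)` anticommutes with every antidiagonal matrix.
    (Subgroup.mem_center_iff.1 h (diagGL (1, -1)))
  have h2 : (p.1 : ℂ) = -p.1 := by simpa [coe_diagGL, coe_swapGL] using h1
  exact p.1.ne_zero (by linear_combination h2 / 2)

theorem exists_unit_sq_eq (x : ℂˣ) : ∃ y : ℂˣ, y ^ 2 = x := by
  obtain ⟨y, hy⟩ := IsAlgClosed.exists_pow_nat_eq (x : ℂ) two_pos
  have hy0 : y ≠ 0 := by
    rintro rfl
    exact x.ne_zero (by simpa using hy.symm)
  exact ⟨Units.mk0 y hy0, Units.ext hy⟩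

theorem exists_isPrimitiveRoot_units {n : ℕ} (hn : n ≠ 0) : ∃ ω : ℂˣ, IsPrimitiveRoot ω n := by
  have h := Complex.isPrimitiveRoot_exp n hn
  exact ⟨(h.isUnit hn).unit, IsPrimitiveRoot.coe_units_iff.1 h⟩

theorem IsPrimitiveRoot.pow_half_eq_neg_one {ω : ℂˣ} {n : ℕ} (hω : IsPrimitiveRoot ω n)
    (hn : 0 < n) (hn2 : Even n) : ω ^ (n / 2) = -1 := by
  have h1 : ω ^ (n / 2) ≠ 1 := hω.pow_ne_one_of_pos_of_lt (by grind) (by omega)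
  have h2 : ((ω ^ (n / 2) : ℂˣ) : ℂ) ^ 2 = 1 := by
    rw [← Units.val_pow_eq_pow_val, ← pow_mul, Nat.div_mul_cancel hn2.two_dvd, hω.pow_eq_one,
      Units.val_one]
  exact Units.ext ((sq_eq_one_iff.1 h2).resolve_left fun h => h1 (Units.ext h))

/-- Eigenvalues of the rotation: `a / b` is a primitive `n`-th root of unity. -/
theorem exists_eigenvalues {n m : ℕ} (hn : 0 < n) (hm : 0 < m) (hn2 : Even n) (hm2 : Even m)
    {α s : ℤ} (h : ((n / 2 : ℕ) : ℤ) * s ≡ α + ((m / 2 : ℕ) : ℤ) [ZMOD (m : ℤ)])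
    {ζ : ℂˣ} (hζ : IsPrimitiveRoot ζ m) :
    ∃ a b : ℂˣ, a ^ n = ζ ^ α ∧ b ^ n = ζ ^ α ∧ a * b = ζ ^ s ∧ IsPrimitiveRoot (a / b) n := by
  obtain ⟨ω, hω⟩ := exists_isPrimitiveRoot_units hn.ne'
  -- Forced by `a b = ζ ^ s` and `a / b = ω`. Then `a ^ n = ω ^ (n / 2) ζ ^ ((n / 2) s)`, where both
  -- factors carry a sign `-1`.
  obtain ⟨a, ha⟩ := exists_unit_sq_eq (ω * ζ ^ s)
  have hz : ζ ^ (((n / 2 : ℕ) : ℤ) * s) = -ζ ^ α := by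
    have h' : ζ ^ (((n / 2 : ℕ) : ℤ) * s) = ζ ^ (α + ((m / 2 : ℕ) : ℤ)) :=
      zpow_eq_zpow_iff_modEq.2 (by rw [← hζ.eq_orderOf]; exact h)
    rw [h', zpow_add, zpow_natCast,
      hζ.pow_half_eq_neg_one hm hm2, mul_neg_one]
  have hn' : n = 2 * (n / 2) := (Nat.mul_div_cancel' hn2.two_dvd).symm
  have han : a ^ n = ζ ^ α := by
    rw [hn', pow_mul, ha, mul_pow, hω.pow_half_eq_neg_one hn hn2, ← zpow_natCast (ζ ^ s),
      ← zpow_mul, mul_comm s, hz, neg_one_mul, neg_neg]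
  have hsn : (ζ ^ s) ^ n = ζ ^ α * ζ ^ α := by
    rw [hn', mul_comm 2, pow_mul, ← zpow_natCast (ζ ^ s), ← zpow_mul, mul_comm s, hz, neg_sq, sq]
  refine ⟨a, ζ ^ s / a, han, ?_, mul_div_cancel _ _, ?_⟩
  · rw [div_pow, hsn, han, mul_div_cancel_right]
  · have : a / (ζ ^ s / a) = ω := by
      rw [div_div_eq_mul_div, ← sq, ha, mul_div_cancel_right]
    rwa [this]

/-- The matrices satisfying the relations. -/
theorem dihExtRelations_diagGL {n m : ℕ} {α β γ : ℤ} (hn : 0 < n) {a b y ζ : ℂˣ}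
    (hζ : ζ ^ m = 1) (ha : a ^ n = ζ ^ α) (hb : b ^ n = ζ ^ α) (hab : a * b = ζ ^ (α + γ))
    (hy : y ^ 2 = ζ ^ β) :
    DihExtRelations n m α β γ (diagGL (a, b)) (diagGL (y, y) * swapGL) (diagGL (ζ, ζ)) where
  pow_X := by rw [← map_pow, ← map_zpow, Prod.pow_mk, ha, hb]; rfl
  sq_Y := by
    rw [sq, mul_assoc, ← mul_assoc swapGL, swapGL_mul_diagGL, Prod.swap_prod_mk, mul_assoc,
      swapGL_mul_self, mul_one, ← map_mul, ← map_zpow, Prod.mk_mul_mk, ← sq, hy]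
    rfl
  Y_mul_X := by
    have key : ∀ c d : ℂˣ, c ^ n = ζ ^ α → c * d = ζ ^ (α + γ) → d = c ^ (n - 1) * ζ ^ γ := by
      intro c d hc hcd
      apply mul_left_cancel (a := c)
      rw [hcd, ← mul_assoc, ← pow_succ', Nat.sub_add_cancel hn, hc, zpow_add]
    rw [mul_assoc, swapGL_mul_diagGL, ← map_pow, ← map_zpow, mul_assoc, mul_assoc,
      swapGL_mul_diagGL, ← mul_assoc, ← mul_assoc, ← mul_assoc, ← map_mul, ← map_mul, ← map_mul]
    congr 2
    refine Prod.ext ?_ ?_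
    · change y * b = a ^ (n - 1) * y * ζ ^ γ
      rw [key a b ha hab, mul_left_comm, mul_assoc]
    · change y * a = b ^ (n - 1) * y * ζ ^ γ
      rw [key b a hb (mul_comm a b ▸ hab), mul_left_comm, mul_assoc]
  commute_YZ := by
    change diagGL (y, y) * swapGL * diagGL (ζ, ζ) = diagGL (ζ, ζ) * (diagGL (y, y) * swapGL)
    rw [mul_assoc, swapGL_mul_diagGL, Prod.swap_prod_mk, ← mul_assoc, ← mul_assoc, ← map_mul,
      ← map_mul, mul_comm]
  commute_XZ := (Commute.all (a, b) (ζ, ζ)).map diagGL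
  pow_Z := by rw [← map_pow, Prod.pow_mk, hζ]; exact map_one diagGL

/-- A representation whose image contains `diag (a, b)` with `a ≠ b` and an antidiagonal matrix is
irreducible. -/
theorem isIrreducible_of_diagGL {G : Type*} [Group G] {ρ : G →* GeneralLinearGroup (Fin 2) ℂ}
    {X Y : G} {a b y : ℂˣ} (hX : ρ X = diagGL (a, b)) (hY : ρ Y = diagGL (y, y) * swapGL)
    (hab : a ≠ b) : (repOfGL ρ).IsIrreducible := by
  have hrep (g : G) (v : Fin 2 → ℂ) : repOfGL ρ g v = (ρ g : Matrix (Fin 2) (Fin 2) ℂ) *ᵥ v := rfl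
  have hXv (v : Fin 2 → ℂ) : repOfGL ρ X v = ![a * v 0, b * v 1] := by
    rw [hrep, hX, coe_diagGL]
    ext i
    fin_cases i <;> simp [Matrix.mulVec, dotProduct]
  have hYv (v : Fin 2 → ℂ) : repOfGL ρ Y v = ![y * v 1, y * v 0] := by
    rw [hrep, hY, Units.val_mul, coe_diagGL, coe_swapGL]
    ext i
    fin_cases i <;> simp [Matrix.mulVec, dotProduct]
  have hab' : (a : ℂ) - b ≠ 0 := sub_ne_zero.2 fun h => hab (Units.ext h)
  have : Nontrivial (Subrepresentation (repOfGL ρ)) := ⟨⊥, ⊤, fun h => by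
    have h' : (⊥ : Submodule ℂ (Fin 2 → ℂ)) = ⊤ := congrArg Subrepresentation.toSubmodule h
    exact bot_ne_top h'⟩
  refine ⟨fun W => or_iff_not_imp_left.2 fun hW => ?_⟩
  obtain ⟨v, hv, hv0⟩ : ∃ v ∈ W.toSubmodule, v ≠ 0 := by
    refine W.toSubmodule.exists_mem_ne_zero_of_ne_bot fun h => hW ?_
    exact Subrepresentation.toSubmodule_injective h
  have hswap : ∀ w ∈ W.toSubmodule, ![w 1, w 0] ∈ W.toSubmodule := by
    intro w hw
    have h := W.toSubmodule.smul_mem (y : ℂ)⁻¹ (W.apply_mem_toSubmodule Y hw)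
    rw [hYv] at h
    simpa using h
  have hfirst : ∀ w ∈ W.toSubmodule, w 0 ≠ 0 → ![1, 0] ∈ W.toSubmodule := by
    intro w hw hw0
    -- `X - b` kills the second coordinate and scales the first by `a - b ≠ 0`.
    have h := W.toSubmodule.smul_mem ((a - b) * w 0 : ℂ)⁻¹
      (W.toSubmodule.sub_mem (W.apply_mem_toSubmodule X hw) (W.toSubmodule.smul_mem (b : ℂ) hw))
    rw [hXv] at h
    convert h using 1
    ext i
    fin_cases i
    · change (1 : ℂ) = ((a - b) * w 0)⁻¹ * (a * w 0 - b * w 0)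
      field_simp
    · change (0 : ℂ) = ((a - b) * w 0)⁻¹ * (b * w 1 - b * w 1)
      rw [sub_self, mul_zero]
  have h10 : ![1, 0] ∈ W.toSubmodule := by
    by_cases h0 : v 0 = 0
    · refine hfirst _ (hswap v hv) fun h1 => hv0 ?_
      ext i
      fin_cases i
      exacts [h0, h1]
    · exact hfirst v hv h0
  have h01 : ![0, 1] ∈ W.toSubmodule := by simpa using hswap _ h10
  apply Subrepresentation.toSubmodule_injective
  refine Submodule.eq_top_iff'.2 fun w => ?_
  have h := W.toSubmodule.add_mem (W.toSubmodule.smul_mem (w 0) h10)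
    (W.toSubmodule.smul_mem (w 1) h01)
  convert h using 1
  ext i
  fin_cases i <;> simp

/-! ### Sufficiency and the equivalence -/

/-- The sufficiency of the congruence. -/
theorem exists_representation_of_congruence {G : Type*} [Group G] {n m : ℕ} (hn : 2 ≤ n)
    (hm : 0 < m) (hn2 : Even n) (hm2 : Even m) {X Y Z : G} {α β γ : ℤ}
    (hG : IsGivenBy n m X Y Z α β γ)
    (h : ((n / 2 : ℕ) : ℤ) * (α + γ) ≡ α + ((m / 2 : ℕ) : ℤ) [ZMOD (m : ℤ)]) :
    IsDihedralCentralExtension n m X Y Z ∧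
      ∃ ρ : G →* GeneralLinearGroup (Fin 2) ℂ,
        Function.Injective ρ ∧
        (repOfGL ρ).IsIrreducible ∧
        Nonempty (projImage ρ ≃* DihedralGroup n) := by
  have hn0 : 0 < n := by omega
  obtain ⟨ζ, hζ⟩ := exists_isPrimitiveRoot_units hm.ne'
  obtain ⟨a, b, ha, hb, hab, hprim⟩ := exists_eigenvalues hn0 hm hn2 hm2 h hζ
  obtain ⟨y, hy⟩ := exists_unit_sq_eq (ζ ^ β)
  obtain ⟨ρ, hX, hY, hZ⟩ := hG.exists_hom
    (dihExtRelations_diagGL hn0 hζ.pow_eq_one ha hb hab hy)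
  have hZk (k : ℤ) : ρ (Z ^ k) = diagGL (ζ ^ k, ζ ^ k) := by
    rw [map_zpow, hZ, ← map_zpow]; rfl
  have hZ1 (k : ℤ) (hk : ρ (Z ^ k) = 1) : Z ^ k = 1 := by
    rw [hZk, ← map_one diagGL] at hk
    obtain ⟨j, rfl⟩ := (hζ.zpow_eq_one_iff_dvd k).1 (congrArg Prod.fst (diagGL_injective hk))
    rw [zpow_mul, zpow_natCast, hG.relations.pow_Z, one_zpow]
  -- The image of `Z` has order `m`, so `Z` cannot collapse to a smaller order.
  have hord : orderOf Z = m := by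
    refine Nat.dvd_antisymm (orderOf_dvd_of_pow_eq_one hG.relations.pow_Z) ?_
    refine hζ.dvd_of_pow_eq_one _ ?_
    have h1 := hZk (orderOf Z)
    rw [zpow_natCast, pow_orderOf_eq_one, map_one, ← map_one diagGL, zpow_natCast] at h1
    exact (congrArg Prod.fst (diagGL_injective h1)).symm
  have hE := hG.isDihedralCentralExtension hn0 hord
  -- As `a / b` has order `n`, `X ^ i Z ^ k` becomes scalar only if `n ∣ i`, and then `X ^ i` is a
  -- power of `Z`; elements involving `Y` become antidiagonal.
  have hcenter (g : G) (hg : ρ g ∈ Subgroup.center (GeneralLinearGroup (Fin 2) ℂ)) :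
      g ∈ Subgroup.zpowers Z := by
    rcases hG.relations.normal_form hn0 hG.closure_eq_top g with ⟨i, k, rfl⟩ | ⟨i, k, rfl⟩
    · rw [map_mul, map_zpow, hX, hZk, ← map_zpow, ← map_mul, diagGL_mem_center_iff] at hg
      have hi : (a / b) ^ i = 1 := by
        rw [div_zpow, div_eq_one]
        exact mul_right_cancel hg
      obtain ⟨j, rfl⟩ := (hprim.zpow_eq_one_iff_dvd i).1 hi
      rw [zpow_mul, zpow_natCast, hG.relations.pow_X, ← zpow_mul, ← zpow_add]
      exact Subgroup.zpow_mem_zpowers Z _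
    · rw [mul_assoc, (hG.relations.commute_YZ.zpow_right k).eq, ← mul_assoc, map_mul, map_mul,
        map_zpow, hX, hZk, hY, ← map_zpow, ← mul_assoc, ← map_mul, ← map_mul] at hg
      exact absurd hg (diagGL_mul_swapGL_notMem_center _)
  refine ⟨hE, ρ, ?_, ?_, ?_⟩
  · rw [injective_iff_map_eq_one]
    intro g hg
    obtain ⟨k, rfl⟩ := hcenter g (hg ▸ Subgroup.one_mem _)
    exact hZ1 k hg
  · refine isIrreducible_of_diagGL hX hY fun hab' => ?_
    rw [hab', div_self', IsPrimitiveRoot.one_left_iff] at hprim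
    omega
  · obtain ⟨S, -, hSZ, hSX, hSY⟩ := hE
    have hSZ' : S.rightHom Z = 1 := by
      rw [← MonoidHom.mem_ker, ← S.range_inl_eq_ker_rightHom, ← hSZ]
      exact ⟨_, rfl⟩
    -- Both kernels equal `⟨Z⟩`, so both images are the same quotient of `G`.
    have hker : (ProjGenLinGroup.mk.comp ρ).ker = S.rightHom.ker := by
      rw [hG.ker_eq_zpowers hn0 hSX hSY hSZ']
      apply le_antisymm
      · intro g hg
        exact hcenter g (ProjGenLinGroup.mk_eq_one.1 hg)
      · rw [Subgroup.zpowers_le, MonoidHom.mem_ker, MonoidHom.comp_apply,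
          ProjGenLinGroup.mk_eq_one, hZ, diagGL_mem_center_iff]
    exact ⟨(QuotientGroup.quotientKerEquivRange _).symm.trans
      ((QuotientGroup.quotientMulEquivOfEq hker).trans
        (QuotientGroup.quotientKerEquivOfSurjective _ S.rightHom_surjective))⟩

theorem mainTheorem6 {G : Type*} [Group G] (n m : ℕ) (hn : 3 ≤ n) (hm : 0 < m)
    (hn2 : Even n) (hm2 : Even m) (X Y Z : G) (α β γ : ℤ)
    (hG : IsGivenBy n m X Y Z α β γ) :
    (IsDihedralCentralExtension n m X Y Z ∧
      ∃ ρ : G →* Matrix.GeneralLinearGroup (Fin 2) ℂ,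
        Function.Injective ρ ∧
        (repOfGL ρ).IsIrreducible ∧
        Nonempty (projImage ρ ≃* DihedralGroup n)) ↔
    ((n / 2 : ℕ) : ℤ) * (α + γ) ≡ α + ((m / 2 : ℕ) : ℤ) [ZMOD (m : ℤ)] := by
  constructor
  · rintro ⟨hE, ρ, -, hρ, hP⟩
    exact congruence_of_representation (by omega) hn2 hm2 hG hE hρ hP
  · exact exists_representation_of_congruence (by omega) hm hn2 hm2 hG
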